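/- Let $d\ge 2$ and let $\mathbb{L}^d=(\mathbb{Z}^d,\mathbb{E}^d)$ be the cubic lattice with nearest-neighbour edges. Let $\mu=\mu_d=\lim_{n\to\infty}\sigma_n^{1/n}$ be its connective constant, where $\sigma_n$ is the number of $n$-step self-avoiding walks on $\mathbb{L}^d$ starting at the origin. A facet of $\mathbb{Z}^d$ is a set $x+(A_1\times\dots\times A_d)$ with $x\in\mathbb{Z}^d$ and each $A_i$ equal to $\{0\}$ or $\{0,1\}$; it is a $k$-facet if $\{0,1\}$ occurs $k$ times. The facets of the dual lattice are the translates of the facets of $\mathbb{Z}^d$ by $(\tfrac12,\dots,\tfrac12)$. Two facets of different dimensions are incident if one is a subset of the other. A plaquette is a $(d-1)$-facet of the dual lattice; each edge $e\in\mathbb{E}^d$ (a $1$-facet of $\mathbb{Z}^d$) has a unique dual plaquette $\pi(e)$, the one with the same centre of mass. Two plaquettes are adjacent if some $(d-2)$-facet of the dual lattice is incident to both. A surface is a (finite or infinite) set of plaquettes that is connected with respect to adjacency and such that every $(d-2)$-facet of the dual lattice is incident to an even number of its elements. Each plaquette is identified with the closed convex hull of its points in $\mathbb{R}^d$, and a surface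 with the union of the resulting cubes; a surface is uniformly homeomorphic to a hyperplane if there is a bijection from this union to $\{0\}\times\mathbb{R}^{d-1}$ that is uniformly continuous with uniformly continuous inverse. Let $p\in[0,1]$ and consider bond percolation on $\mathbb{L}^d$: each edge is open with probability $p$ and closed otherwise, independently of the other edges. The plaquette $\pi(e)$ is declared open if and only if the edge $e$ is closed. If $p<\mu^{-2}$, then almost surely there exists a set of infinitely many open plaquettes that is a surface and is uniformly homeomorphic to a hyperplane. -/

import Mathlib

open Filter Topology MeasureTheory ProbabilityTheory

namespace PlaquettePercolation

/-! ### Facets of the cubic lattice -/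

/-- A facet `x + (A₁ × ⋯ × A_d)` of `ℤ^d`, where `A_i = {0, 1}` for `i ∈ dirs` and
`A_i = {0}` otherwise. It is recorded by its base point `x` and the set `dirs`; both are
determined by the set of points of the facet, see `Facet.verts_injective`. -/
structure Facet (d : ℕ) where
  base : Fin d → ℤ
  dirs : Finset (Fin d)

namespace Facet

variable {d : ℕ}

/-- The set of points of `ℤ^d` that make up the facet. -/
def verts (F : Facet d) : Set (Fin d → ℤ) :=
  {y | ∀ i, y i = F.base i ∨ (i ∈ F.dirs ∧ y i = F.base i + 1)}

/-- The dimension of a facet: `F` is a `k`-facet when `F.dim = k`. -/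
def dim (F : Facet d) : ℕ := F.dirs.card

/-- Two facets of different dimensions are incident if one is a subset of the other. -/
def Incident (F G : Facet d) : Prop :=
  F.dim ≠ G.dim ∧ (F.verts ⊆ G.verts ∨ G.verts ⊆ F.verts)

theorem verts_injective : Function.Injective (verts : Facet d → Set (Fin d → ℤ)) := by
  have hb : ∀ F G : Facet d, F.verts = G.verts → ∀ i, G.base i ≤ F.base i := by
    intro F G h i
    have h1 : F.base ∈ G.verts := h ▸ (fun i => Or.inl rfl : F.base ∈ F.verts)
    rcases h1 i with h2 | ⟨_, h2⟩ <;> omega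
  have hd : ∀ F G : Facet d, F.base = G.base → F.verts = G.verts → F.dirs ⊆ G.dirs := by
    intro F G hFG h i hi
    have h0 : (fun j => if j = i then F.base j + 1 else F.base j) ∈ F.verts := by
      intro j
      by_cases hj : j = i
      · subst hj; simp [hi]
      · simp [hj]
    rw [h] at h0
    rcases h0 i with h2 | ⟨h2, _⟩
    · simp [hFG] at h2
    · exact h2
  intro F G h
  have h1 : F.base = G.base := funext fun i => le_antisymm (hb G F h.symm i) (hb F G h i)
  have h2 : F.dirs = G.dirs :=
    Finset.Subset.antisymm (hd F G h1 h) (hd G F h1.symm h.symm)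
  cases F; cases G; simp_all

/-- The facets of the dual lattice `ℤ^d + (1/2, …, 1/2)` are the translates `F + (1/2, …, 1/2)`
of the facets `F` of `ℤ^d`. We denote `F + (1/2, …, 1/2)` by the same symbol `F`;
this is the set of its points. -/
def shiftedVerts (F : Facet d) : Set (EuclideanSpace ℝ (Fin d)) :=
  {z | ∃ y ∈ F.verts, ∀ i, z i = (y i : ℝ) + 1 / 2}

/-- The dual of a `k`-facet `F` of `ℤ^d`: the `(d-k)`-facet of `ℤ^d + (1/2, …, 1/2)`
with the same centre of mass. It is obtained by replacing each factor `{0, 1}` of `F` by `{1/2}`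
and each factor `{0}` by `{-1/2, 1/2}`, see `Facet.mem_shiftedVerts_dual`. The result is
the translate by `(1/2, …, 1/2)` of the facet given here. -/
def dual (F : Facet d) : Facet d where
  base i := if i ∈ F.dirs then F.base i else F.base i - 1
  dirs := F.dirsᶜ

theorem mem_shiftedVerts_dual (F : Facet d) (z : EuclideanSpace ℝ (Fin d)) :
    z ∈ F.dual.shiftedVerts ↔ ∀ i,
      if i ∈ F.dirs then z i = F.base i + 1 / 2
      else (z i = F.base i - 1 / 2 ∨ z i = F.base i + 1 / 2) := by
  constructor
  · rintro ⟨y, hy, hz⟩ i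
    have h := hy i
    rw [hz i]
    by_cases hi : i ∈ F.dirs
    · simp only [dual, hi, if_true, Finset.mem_compl, not_true, false_and, or_false] at h ⊢
      rw [h]
    · simp only [dual, hi, if_false, Finset.mem_compl, not_false_iff, true_and] at h ⊢
      rcases h with h | h
      · left; rw [h]; push_cast; ring
      · right; rw [h]; push_cast; ring
  · intro h
    refine ⟨fun i => if z i = F.base i + 1 / 2 then F.base i else F.base i - 1, ?_, ?_⟩
    · intro i
      have h := h i
      by_cases hi : i ∈ F.dirs
      · simp only [hi, if_true] at h
        simp [dual, hi, h]
      · simp only [dual, hi, if_false, Finset.mem_compl, not_false_iff, true_and]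
        split_ifs <;> simp
    · intro i
      have h := h i
      by_cases hi : i ∈ F.dirs
      · simp only [hi, if_true] at h
        simp [h]
      · simp only [hi, if_false] at h
        rcases h with h | h
        · have : z i ≠ F.base i + 1 / 2 := by rw [h]; intro h'; linarith
          dsimp only
          rw [if_neg this, h]; push_cast; ring
        · dsimp only
          rw [if_pos h, h]

/-- The cube in `ℝ^d` spanned by a facet of the dual lattice `ℤ^d + (1/2, …, 1/2)`: the convex
hull of its (finitely many) points, which is automatically closed. -/
def cube (F : Facet d) : Set (EuclideanSpace ℝ (Fin d)) := convexHull ℝ F.shiftedVerts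

end Facet

/-- The edges of the lattice `ℤ^d`: its `1`-facets. -/
abbrev Edge (d : ℕ) := {F : Facet d // F.dim = 1}

/-- The plaquettes of the dual lattice `ℤ^d + (1/2, …, 1/2)`: its `(d-1)`-facets. -/
abbrev Plaquette (d : ℕ) := {F : Facet d // F.dim + 1 = d}

/-- The plaquette `π(e)` dual to the edge `e`. -/
def dualPlaquette {d : ℕ} (e : Edge d) : Plaquette d :=
  ⟨e.1.dual, by
    have h : e.1.dirs.card = 1 := e.2
    have h' := Finset.card_compl_add_card e.1.dirs
    rw [h, Fintype.card_fin] at h'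
    exact h'⟩

/-- The lattice `𝕃^d = (ℤ^d, 𝔼^d)`. -/
def lattice (d : ℕ) : SimpleGraph (Fin d → ℤ) where
  Adj u v := u ≠ v ∧ ∃ e : Edge d, e.1.verts = {u, v}
  symm := ⟨fun _ _ h => ⟨h.1.symm, by simpa only [Set.pair_comm] using h.2⟩⟩
  loopless := ⟨fun _ h => h.1 rfl⟩

/-! ### The connective constant -/

/-- The self-avoiding walks with `n` steps on `𝕃^d` that start at the origin. -/
def saws (d n : ℕ) : Set (Fin (n + 1) → Fin d → ℤ) :=
  {w | w 0 = 0 ∧ Function.Injective w ∧ ∀ i : Fin n, (lattice d).Adj (w i.castSucc) (w i.succ)}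

/-- The number of self-avoiding walks with `n` steps on `𝕃^d` that start at the origin. -/
noncomputable def sawCount (d n : ℕ) : ℕ := (saws d n).ncard

/-- The connective constant `μ_d = lim_{n → ∞} σ_n ^ (1/n)` of `𝕃^d`, with `σ_n` the number of
`n`-step self-avoiding walks from the origin. The limit exists,
see `tendsto_connectiveConstant`. -/
noncomputable def connectiveConstant (d : ℕ) : ℝ :=
  limUnder atTop fun n : ℕ => (sawCount d n : ℝ) ^ (1 / (n : ℝ))

theorem lattice_adj_iff {d : ℕ} {u v : Fin d → ℤ} :
    (lattice d).Adj u v ↔ ∃ i, v = u + Pi.single i 1 ∨ u = v + Pi.single i 1 := by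
  have key : ∀ (F : Facet d) (i : Fin d), F.dirs = {i} →
      F.verts = {F.base, F.base + Pi.single i 1} := by
    intro F i hi
    ext y
    simp only [Facet.verts, hi, Finset.mem_singleton, Set.mem_ofPred_eq, Set.mem_insert_iff,
      Set.mem_singleton_iff]
    constructor
    · intro h
      rcases h i with h1 | ⟨_, h1⟩
      · left
        funext j
        rcases h j with h2 | ⟨h2, h3⟩
        · exact h2
        · subst h2; exact h1
      · right
        funext j
        by_cases hj : j = i
        · subst hj; simp [h1]
        · rcases h j with h2 | ⟨h2, h3⟩
          · simp [hj, h2]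
          · exact absurd h2 hj
    · rintro (rfl | rfl) j
      · exact Or.inl rfl
      · by_cases hj : j = i
        · subst hj; simp
        · simp [hj]
  constructor
  · rintro ⟨hne, ⟨F, hF⟩, h⟩
    obtain ⟨i, hi⟩ := Finset.card_eq_one.1 hF
    refine ⟨i, ?_⟩
    dsimp only at h
    rw [key F i hi, Set.pair_eq_pair_iff] at h
    rcases h with ⟨h1, h2⟩ | ⟨h1, h2⟩
    · left; rw [← h1, ← h2]
    · right; rw [← h1, ← h2]
  · have h1 : ∀ (u : Fin d → ℤ) (i : Fin d), u ≠ u + Pi.single i 1 := by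
      intro u i h
      have := congrFun h i
      simp at this
    rintro ⟨i, rfl | rfl⟩
    · exact ⟨h1 u i, ⟨⟨u, {i}⟩, by simp [Facet.dim]⟩, key _ i rfl⟩
    · exact ⟨(h1 v i).symm, ⟨⟨v, {i}⟩, by simp [Facet.dim]⟩, by
        rw [Set.pair_comm]; exact key _ i rfl⟩

theorem saws_finite (d n : ℕ) : (saws d n).Finite := by
  have hfin : (Set.pi Set.univ fun _ : Fin (n + 1) => Set.pi Set.univ fun _ : Fin d =>
      Set.Icc (-(n : ℤ)) n).Finite :=
    Set.Finite.pi fun _ => Set.Finite.pi fun _ => Set.finite_Icc _ _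
  refine hfin.subset ?_
  rintro w ⟨h0, -, hadj⟩
  have hb : ∀ i : Fin (n + 1), ∀ j, |w i j| ≤ (i : ℕ) := by
    intro i
    induction i using Fin.induction with
    | zero => simp [h0]
    | succ i ih =>
      intro j
      have h1 := ih j
      obtain ⟨k, hk | hk⟩ := lattice_adj_iff.1 (hadj i)
      · have h2 := congrFun hk j
        rw [Pi.add_apply, Pi.single_apply] at h2
        simp only [Fin.val_castSucc, Fin.val_succ, abs_le] at h1 ⊢
        push_cast
        split_ifs at h2 <;> constructor <;> omega
      · have h2 := congrFun hk j
        rw [Pi.add_apply, Pi.single_apply] at h2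
        simp only [Fin.val_castSucc, Fin.val_succ, abs_le] at h1 ⊢
        push_cast
        split_ifs at h2 <;> constructor <;> omega
  intro i _ j _
  have h1 := abs_le.1 (hb i j)
  have h2 := i.2
  constructor <;> omega

theorem sawCount_add_le (d m n : ℕ) : sawCount d (m + n) ≤ sawCount d m * sawCount d n := by
  unfold sawCount
  rw [← Set.ncard_prod]
  let a : Fin (m + 1) → Fin (m + n + 1) := fun i => ⟨i, by omega⟩
  let b : Fin (n + 1) → Fin (m + n + 1) := fun i => ⟨m + i, by omega⟩
  refine Set.ncard_le_ncard_of_injOn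
    (fun w => (fun i => w (a i), fun i => w (b i) - w (b 0))) ?_ ?_
    ((saws_finite d m).prod (saws_finite d n))
  · rintro w ⟨h0, hinj, hadj⟩
    refine ⟨⟨h0, fun i j h => ?_, fun i => ?_⟩, ⟨?_, fun i j h => ?_, fun i => ?_⟩⟩
    · have := hinj h
      simpa [a, Fin.ext_iff] using this
    · exact hadj ⟨i, by omega⟩
    · simp
    · have := hinj (sub_left_injective h)
      simpa [b, Fin.ext_iff] using this
    · obtain ⟨k, hk⟩ := lattice_adj_iff.1 (hadj ⟨m + i, by omega⟩)
      refine lattice_adj_iff.2 ⟨k, ?_⟩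
      have e1 : (Fin.castSucc ⟨m + i, by omega⟩ : Fin (m + n + 1)) = b i.castSucc := rfl
      have e2 : (Fin.succ ⟨m + i, by omega⟩ : Fin (m + n + 1)) = b i.succ := rfl
      rw [e1, e2] at hk
      dsimp only
      rcases hk with hk | hk
      · left; rw [hk]; abel
      · right; rw [hk]; abel
  · rintro w - w' - h
    simp only [Prod.mk.injEq] at h
    obtain ⟨h1, h2⟩ := h
    have hb0 : w (b 0) = w' (b 0) := congrFun h1 (Fin.last m)
    funext i
    by_cases hi : (i : ℕ) < m + 1
    · exact congrFun h1 ⟨i, hi⟩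
    · have h3 := congrFun h2 ⟨i - m, by omega⟩
      have e : b ⟨i - m, by omega⟩ = i := by
        apply Fin.ext; simp only [b]; omega
      simp only [e, hb0] at h3
      exact sub_left_injective h3

theorem sawCount_pos {d : ℕ} (hd : 1 ≤ d) (n : ℕ) : 0 < sawCount d n := by
  refine (Set.ncard_pos (saws_finite d n)).2 ⟨fun i => Pi.single ⟨0, hd⟩ (i : ℤ), ?_, ?_, ?_⟩
  · simp
  · intro i j h
    have := Pi.single_injective _ h
    exact Fin.ext (by exact_mod_cast this)
  · intro i
    refine lattice_adj_iff.2 ⟨⟨0, hd⟩, Or.inl ?_⟩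
    rw [← Pi.single_add]
    simp

/-- The limit that defines the connective constant exists. -/
theorem tendsto_connectiveConstant {d : ℕ} (hd : 1 ≤ d) :
    Tendsto (fun n : ℕ => (sawCount d n : ℝ) ^ (1 / (n : ℝ))) atTop
      (𝓝 (connectiveConstant d)) := by
  have hpos : ∀ n, (0 : ℝ) < sawCount d n := fun n => by exact_mod_cast sawCount_pos hd n
  have hsub : Subadditive fun n => Real.log (sawCount d n) := by
    intro m n
    rw [← Real.log_mul (hpos m).ne' (hpos n).ne']
    exact Real.log_le_log (hpos _) (by exact_mod_cast sawCount_add_le d m n)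
  have hbdd : BddBelow (Set.range fun n : ℕ => Real.log (sawCount d n) / n) := by
    refine ⟨0, ?_⟩
    rintro _ ⟨n, rfl⟩
    exact div_nonneg (Real.log_nonneg (by exact_mod_cast sawCount_pos hd n)) (Nat.cast_nonneg n)
  have h := (Real.continuous_exp.tendsto _).comp (hsub.tendsto_lim hbdd)
  refine tendsto_nhds_limUnder ⟨_, h.congr fun n => ?_⟩
  rw [Function.comp_apply, Real.rpow_def_of_pos (hpos n)]
  congr 1
  ring

/-! ### Surfaces of plaquettes -/

/-- Two distinct plaquettes are adjacent if some `(d-2)`-facet is incident to both. -/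
def plaquetteGraph (d : ℕ) : SimpleGraph (Plaquette d) where
  Adj P Q := P ≠ Q ∧ ∃ F : Facet d, F.dim + 2 = d ∧ F.Incident P.1 ∧ F.Incident Q.1
  symm := ⟨fun _ _ h => ⟨h.1.symm, h.2.imp fun _ hF => ⟨hF.1, hF.2.2, hF.2.1⟩⟩⟩
  loopless := ⟨fun _ h => h.1 rfl⟩

/-- The boundary of a set of plaquettes: the set of all `(d-2)`-facets that are incident to an
odd number of its elements. -/
def boundary {d : ℕ} (S : Set (Plaquette d)) : Set (Facet d) :=
  {F | F.dim + 2 = d ∧ Odd {P ∈ S | F.Incident P.1}.ncard}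

/-- A surface is a connected set of plaquettes with empty boundary. -/
def IsSurface {d : ℕ} (S : Set (Plaquette d)) : Prop :=
  ((plaquetteGraph d).induce S).Connected ∧ boundary S = ∅

/-- The subset of `ℝ^d` covered by the cubes of the plaquettes in `S`. -/
def carrier {d : ℕ} (S : Set (Plaquette d)) : Set (EuclideanSpace ℝ (Fin d)) :=
  ⋃ P ∈ S, P.1.cube

/-- The hyperplane `{0} × ℝ^(d-1)` of `ℝ^d`. -/
def hyperplane (d : ℕ) : Set (EuclideanSpace ℝ (Fin d)) :=
  {x | ∀ i : Fin d, (i : ℕ) = 0 → x i = 0}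

/-- There is a bijection from the union of the cubes of `S` to the hyperplane `{0} × ℝ^(d-1)`
that is uniformly continuous with uniformly continuous inverse. -/
def UniformlyHomeomorphicToHyperplane {d : ℕ} (S : Set (Plaquette d)) : Prop :=
  Nonempty (carrier S ≃ᵤ hyperplane d)

/-! ### Bond percolation -/

/-- Configurations `ω ∈ {0, 1}^(𝔼^d)`: the edge `e` is open if `ω e = true`, and closed
if `ω e = false`. -/
abbrev Config (d : ℕ) := Edge d → Bool

/-- The product measure `ℙ_p` under which each edge is open with probability `p`. -/
noncomputable def bondMeasure (d : ℕ) (p : unitInterval) : Measure (Config d) :=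
  Measure.infinitePi fun _ : Edge d => bernoulliMeasure true false p

/-- The plaquette `π(e)` is open if and only if the edge `e` is closed. -/
def IsOpenPlaquette {d : ℕ} (ω : Config d) (P : Plaquette d) : Prop :=
  ∃ e : Edge d, dualPlaquette e = P ∧ ω e = false

end PlaquettePercolation

open PlaquettePercolation

namespace PlaquettePercolation

/-! ### Incidence of dual facets -/

/-! The surface is the upper boundary of a random lower set. Let D = `reachableSet ω` consist of the
vertices reachable from the half-space of nonpositive coordinate sum when downward steps are always
allowed and upward steps only through open edges. D is a lower set, and every edge leaving D upwards
is closed, so the dual plaquettes (`cutSurface`) are all open.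

The geometry is deterministic and needs only that D is a lower set and that its intersection with
each axis line is bounded above and nonempty. In a unit square, 0 or 2 of the four sides leave D,
whence the empty boundary (`boundary_cutSurface`). Each vertical column has exactly one top, and
tops of neighbouring columns are linked inside the surface (`connected_cutSurface`). Projection
along (1, …, 1) maps the surface bijectively to the hyperplane, with Lipschitz inverse
(`uniformlyHomeomorphic_cutSurface`).

Probability enters only in the bound from above. A self-avoiding walk of n steps from the half-space
to a vertex of nonnegative level has at least n/2 upward steps, through distinct open edges, so it
is available with probability at most p^(n/2). A vertex of level at least N needs n ≥ N, so it lies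
in D with probability at most the tail from N of ∑ σ_n (√p)^n. This series converges because μ√p < 1
(`summable_sawCount_mul_pow`), so almost surely D contains no upward axis ray
(`ae_exists_notMem_reachableSet`). -/

theorem Facet.verts_subset_iff {d : ℕ} {F G : Facet d} :
    F.verts ⊆ G.verts ↔ F.dirs ⊆ G.dirs ∧
      ∀ i, F.base i = G.base i ∨ (i ∈ G.dirs ∧ i ∉ F.dirs ∧ F.base i = G.base i + 1) := by
  constructor
  · intro h
    have h0 : ∀ i, F.base i = G.base i ∨ (i ∈ G.dirs ∧ F.base i = G.base i + 1) :=
      h (fun i => Or.inl rfl : F.base ∈ F.verts)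
    have h1 : ∀ i ∈ F.dirs, i ∈ G.dirs ∧ F.base i = G.base i := by
      intro i hi
      have hv : Function.update F.base i (F.base i + 1) ∈ F.verts := by
        intro j
        by_cases hj : j = i
        · subst hj; simp [hi]
        · simp [hj]
      have h2 := h hv i
      have h3 := h0 i
      simp only [Function.update_self] at h2
      rcases h2 with h2 | ⟨h2, h4⟩
      · exact absurd h2 (by rcases h3 with h3 | ⟨_, h3⟩ <;> omega)
      · exact ⟨h2, by omega⟩
    refine ⟨fun i hi => (h1 i hi).1, fun i => ?_⟩
    by_cases hi : i ∈ F.dirs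
    · exact Or.inl (h1 i hi).2
    · exact (h0 i).imp id fun h => ⟨h.1, hi, h.2⟩
  · rintro ⟨h1, h2⟩ y hy i
    rcases hy i with h | ⟨h, h'⟩
    · rcases h2 i with h3 | ⟨h3, -, h4⟩
      · exact Or.inl (h.trans h3)
      · exact Or.inr ⟨h3, h.trans h4⟩
    · rcases h2 i with h3 | ⟨_, h3, _⟩
      · exact Or.inr ⟨h1 h, by rw [h', h3]⟩
      · exact absurd h h3

/-- The edge from `x` to `x + e_k`. -/
def edgeAt {d : ℕ} (x : Fin d → ℤ) (k : Fin d) : Edge d := ⟨⟨x, {k}⟩, by simp [Facet.dim]⟩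

theorem dualPlaquette_edgeAt_inj {d : ℕ} {x y : Fin d → ℤ} {k l : Fin d} :
    dualPlaquette (edgeAt x k) = dualPlaquette (edgeAt y l) ↔ x = y ∧ k = l := by
  constructor
  · intro h
    have h1 := congrArg Subtype.val h
    simp only [dualPlaquette, edgeAt, Facet.dual, Facet.mk.injEq, compl_inj_iff,
      Finset.singleton_inj] at h1
    obtain ⟨h1, rfl⟩ := h1
    refine ⟨funext fun i => ?_, rfl⟩
    have := congrFun h1 i
    by_cases hi : i = k <;> simpa [hi] using this
  · rintro ⟨rfl, rfl⟩; rfl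

/-- The `(d-2)`-facet dual to the square with corners
`c`, `c + e_i`, `c + e_j` and `c + e_i + e_j`. -/
def squareDual {d : ℕ} (c : Fin d → ℤ) (i j : Fin d) : Facet d := Facet.dual ⟨c, {i, j}⟩

theorem squareDual_dim {d : ℕ} (c : Fin d → ℤ) {i j : Fin d} (hij : i ≠ j) :
    (squareDual c i j).dim + 2 = d := by
  have h := Finset.card_compl_add_card ({i, j} : Finset (Fin d))
  rw [Finset.card_pair hij, Fintype.card_fin] at h
  exact h

theorem exists_eq_squareDual {d : ℕ} {F : Facet d} (hF : F.dim + 2 = d) :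
    ∃ c i j, i ≠ j ∧ F = squareDual c i j := by
  have h := Finset.card_compl_add_card F.dirs
  rw [Fintype.card_fin] at h
  have h2 : (F.dirsᶜ).card = 2 := by unfold Facet.dim at hF; omega
  obtain ⟨i, j, hij, h3⟩ := Finset.card_eq_two.1 h2
  -- `Facet.dual` lowers the base by 1 in the directions outside the square, which are those of `F`;
  -- the witness undoes this shift.
  refine ⟨fun l => if l ∈ F.dirs then F.base l + 1 else F.base l, i, j, hij, ?_⟩
  rw [squareDual, ← h3, Facet.dual]
  cases F with
  | mk b s =>
    congr 1
    · funext l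
      by_cases hl : l ∈ s <;> simp [hl]
    · simp

/-- Duality reverses inclusion, so the plaquettes incident to the dual of a square are those dual to
its four sides. -/
theorem squareDual_incident_iff {d : ℕ} {c x : Fin d → ℤ} {i j k : Fin d} (hij : i ≠ j) :
    (squareDual c i j).Incident (dualPlaquette (edgeAt x k)).1 ↔
      (k = i ∧ (x = c ∨ x = c + Pi.single j 1)) ∨ (k = j ∧ (x = c ∨ x = c + Pi.single i 1)) := by
  have hd1 := squareDual_dim c hij
  have hd2 := (dualPlaquette (edgeAt x k)).2
  have hne : (squareDual c i j).dim ≠ (dualPlaquette (edgeAt x k)).1.dim := by omega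
  have hnot : ¬ (dualPlaquette (edgeAt x k)).1.verts ⊆ (squareDual c i j).verts := by
    intro h
    have := Finset.card_le_card (Facet.verts_subset_iff.1 h).1
    unfold Facet.dim at hd1 hd2
    omega
  rw [Facet.Incident, and_iff_right hne, or_iff_left hnot, Facet.verts_subset_iff]
  simp only [squareDual, dualPlaquette, edgeAt, Facet.dual, Finset.mem_insert,
    Finset.mem_singleton, Finset.mem_compl, Finset.compl_subset_compl,
    Finset.singleton_subset_iff, not_not]
  have key : ∀ i j : Fin d, i ≠ j →
      ((∀ l, ((if l = i ∨ l = j then c l else c l - 1) = if l = i then x l else x l - 1) ∨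
        (¬ l = i ∧ (l = i ∨ l = j) ∧
          (if l = i ∨ l = j then c l else c l - 1) = (if l = i then x l else x l - 1) + 1)) ↔
        (x = c ∨ x = c + Pi.single j 1)) := by
    intro i j hij
    constructor
    · intro h
      have hj := h j
      have ho : ∀ l, l ≠ j → x l = c l := by
        intro l hl
        have := h l
        by_cases hi : l = i
        · simp only [hi] at this ⊢; simp at this; omega
        · simp [hi, hl] at this; omega
      simp only [or_true, if_true, hij.symm, if_false, not_false_iff, true_and] at hj
      rcases hj with hj | hj
      · right
        funext l
        by_cases hl : l = j
        · subst hl; simp; omega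
        · simp [hl, ho l hl]
      · left
        funext l
        by_cases hl : l = j
        · subst hl; omega
        · exact ho l hl
    · rintro (rfl | rfl) l
      · by_cases hi : l = i
        · simp [hi]
        · by_cases hl : l = j
          · subst hl; simp [hi]
          · simp [hi, hl]
      · by_cases hi : l = i
        · subst hi; simp [hij]
        · by_cases hl : l = j
          · subst hl; simp [hi]
          · simp [hi, hl]
  constructor
  · rintro ⟨rfl | rfl, h⟩
    · exact Or.inl ⟨rfl, (key _ _ hij).1 h⟩
    · refine Or.inr ⟨rfl, (key _ _ hij.symm).1 ?_⟩
      simpa only [or_comm (a := _ = k)] using h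
  · rintro (⟨rfl, h⟩ | ⟨rfl, h⟩)
    · exact ⟨Or.inl rfl, (key _ _ hij).2 h⟩
    · refine ⟨Or.inr rfl, ?_⟩
      have := (key _ _ hij.symm).2 h
      simpa only [or_comm (a := _ = k)] using this

/-! ### The surface bounding a lower set -/

/-- The plaquettes dual to the edges that leave `D` in a positive coordinate direction. -/
def cutSurface {d : ℕ} (D : Set (Fin d → ℤ)) : Set (Plaquette d) :=
  {P | ∃ x k, x ∈ D ∧ x + Pi.single k 1 ∉ D ∧ dualPlaquette (edgeAt x k) = P}

theorem dualPlaquette_mem_cutSurface {d : ℕ} {D : Set (Fin d → ℤ)} {x : Fin d → ℤ} {k : Fin d} :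
    dualPlaquette (edgeAt x k) ∈ cutSurface D ↔ x ∈ D ∧ x + Pi.single k 1 ∉ D := by
  constructor
  · rintro ⟨y, l, h1, h2, h⟩
    obtain ⟨rfl, rfl⟩ := dualPlaquette_edgeAt_inj.1 h
    exact ⟨h1, h2⟩
  · rintro ⟨h1, h2⟩
    exact ⟨x, k, h1, h2, rfl⟩

theorem single_one_nonneg {d : ℕ} (k : Fin d) : (0 : Fin d → ℤ) ≤ Pi.single k 1 :=
  Pi.single_nonneg.2 zero_le_one

/-- Both monotone paths from the least to the greatest corner of a square leave the lower set once
if only the least corner belongs to it, and never if both or neither do. The two paths share no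
side, so 2 or 0 plaquettes are counted. -/
theorem boundary_cutSurface {d : ℕ} {D : Set (Fin d → ℤ)} (hD : IsLowerSet D) :
    boundary (cutSurface D) = ∅ := by
  rw [Set.eq_empty_iff_forall_notMem]
  rintro F ⟨hF, hodd⟩
  obtain ⟨c, i, j, hij, rfl⟩ := exists_eq_squareDual hF
  refine (Nat.not_even_iff_odd.2 hodd) ?_
  have hi0 : c ≤ c + Pi.single i 1 := le_add_of_nonneg_right (single_one_nonneg i)
  have hj0 : c ≤ c + Pi.single j 1 := le_add_of_nonneg_right (single_one_nonneg j)
  have hii : c + Pi.single i 1 ≤ c + Pi.single i 1 + Pi.single j 1 :=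
    le_add_of_nonneg_right (single_one_nonneg j)
  have hjj : c + Pi.single j 1 ≤ c + Pi.single i 1 + Pi.single j 1 := by
    rw [add_right_comm]; exact le_add_of_nonneg_right (single_one_nonneg i)
  have hmem : ∀ P, P ∈ {P ∈ cutSurface D | (squareDual c i j).Incident P.1} ↔
      (P = dualPlaquette (edgeAt c i) ∧ c ∈ D ∧ c + Pi.single i 1 ∉ D) ∨
      (P = dualPlaquette (edgeAt c j) ∧ c ∈ D ∧ c + Pi.single j 1 ∉ D) ∨
      (P = dualPlaquette (edgeAt (c + Pi.single j 1) i) ∧ c + Pi.single j 1 ∈ D ∧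
        c + Pi.single i 1 + Pi.single j 1 ∉ D) ∨
      (P = dualPlaquette (edgeAt (c + Pi.single i 1) j) ∧ c + Pi.single i 1 ∈ D ∧
        c + Pi.single i 1 + Pi.single j 1 ∉ D) := by
    intro P
    constructor
    · rintro ⟨⟨x, k, h1, h2, rfl⟩, h3⟩
      rcases (squareDual_incident_iff hij).1 h3 with ⟨rfl, rfl | rfl⟩ | ⟨rfl, rfl | rfl⟩
      · exact Or.inl ⟨rfl, h1, h2⟩
      · exact Or.inr (Or.inr (Or.inl ⟨rfl, h1, by rwa [add_right_comm]⟩))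
      · exact Or.inr (Or.inl ⟨rfl, h1, h2⟩)
      · exact Or.inr (Or.inr (Or.inr ⟨rfl, h1, h2⟩))
    · rintro (⟨rfl, h⟩ | ⟨rfl, h⟩ | ⟨rfl, h⟩ | ⟨rfl, h⟩)
      · exact ⟨dualPlaquette_mem_cutSurface.2 h, (squareDual_incident_iff hij).2 (by simp)⟩
      · exact ⟨dualPlaquette_mem_cutSurface.2 h, (squareDual_incident_iff hij).2 (by simp)⟩
      · exact ⟨dualPlaquette_mem_cutSurface.2 (by rwa [add_right_comm]),
          (squareDual_incident_iff hij).2 (by simp)⟩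
      · exact ⟨dualPlaquette_mem_cutSurface.2 h, (squareDual_incident_iff hij).2 (by simp)⟩
  have hpair : ∀ {A : Set (Plaquette d)} (P Q : Plaquette d), P ≠ Q →
      (∀ R, R ∈ A ↔ R = P ∨ R = Q) → Even A.ncard := by
    intro A P Q hPQ h
    have : A = {P, Q} := Set.ext h
    rw [this, Set.ncard_pair hPQ]
    exact even_two
  have hempty : ∀ {A : Set (Plaquette d)}, (∀ R, R ∉ A) → Even A.ncard := by
    intro A h
    rw [Set.eq_empty_iff_forall_notMem.2 h, Set.ncard_empty]
    exact Even.zero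
  by_cases hc : c ∈ D
  swap
  · have h1 : c + Pi.single i 1 ∉ D := fun h => hc (hD hi0 h)
    have h2 : c + Pi.single j 1 ∉ D := fun h => hc (hD hj0 h)
    exact hempty fun R hR => by simpa [hc, h1, h2] using (hmem R).1 hR
  by_cases hd : c + Pi.single i 1 + Pi.single j 1 ∈ D
  · have h1 : c + Pi.single i 1 ∈ D := hD hii hd
    have h2 : c + Pi.single j 1 ∈ D := hD hjj hd
    exact hempty fun R hR => by simpa [hc, hd, h1, h2] using (hmem R).1 hR
  by_cases h1 : c + Pi.single i 1 ∈ D <;> by_cases h2 : c + Pi.single j 1 ∈ D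
  · refine hpair (dualPlaquette (edgeAt (c + Pi.single j 1) i))
      (dualPlaquette (edgeAt (c + Pi.single i 1) j))
      (fun h => hij (dualPlaquette_edgeAt_inj.1 h).2) fun R => ?_
    rw [hmem]; simp [h1, h2, hd]
  · refine hpair (dualPlaquette (edgeAt c j)) (dualPlaquette (edgeAt (c + Pi.single i 1) j))
      (fun h => ?_) fun R => ?_
    · simpa using (dualPlaquette_edgeAt_inj.1 h).1
    · rw [hmem]; simp [h1, h2, hd, hc]
  · refine hpair (dualPlaquette (edgeAt c i)) (dualPlaquette (edgeAt (c + Pi.single j 1) i))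
      (fun h => ?_) fun R => ?_
    · simpa using (dualPlaquette_edgeAt_inj.1 h).1
    · rw [hmem]; simp [h1, h2, hd, hc]
  · refine hpair (dualPlaquette (edgeAt c i)) (dualPlaquette (edgeAt c j))
      (fun h => hij (dualPlaquette_edgeAt_inj.1 h).2) fun R => ?_
    rw [hmem]; simp [h1, h2, hd, hc]

/-! ### Connectedness and infiniteness of the cut surface -/

/-- Two plaquettes of `S` are linked if they lie in the same component of `S`. -/
def Linked {d : ℕ} (S : Set (Plaquette d)) (P Q : Plaquette d) : Prop :=
  ∃ (hP : P ∈ S) (hQ : Q ∈ S), ((plaquetteGraph d).induce S).Reachable ⟨P, hP⟩ ⟨Q, hQ⟩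

theorem Linked.symm {d : ℕ} {S : Set (Plaquette d)} {P Q : Plaquette d} (h : Linked S P Q) :
    Linked S Q P := by
  obtain ⟨h1, h2, h3⟩ := h
  exact ⟨h2, h1, h3.symm⟩

theorem Linked.trans {d : ℕ} {S : Set (Plaquette d)} {P Q R : Plaquette d} (h : Linked S P Q)
    (h' : Linked S Q R) : Linked S P R := by
  obtain ⟨h1, h2, h3⟩ := h
  obtain ⟨_, h5, h6⟩ := h'
  exact ⟨h1, h5, h3.trans h6⟩

theorem Linked.refl {d : ℕ} {S : Set (Plaquette d)} {P : Plaquette d} (h : P ∈ S) :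
    Linked S P P :=
  ⟨h, h, SimpleGraph.Reachable.refl _⟩

theorem Linked.of_square {d : ℕ} {S : Set (Plaquette d)} {P Q : Plaquette d} (hP : P ∈ S)
    (hQ : Q ∈ S) {c : Fin d → ℤ} {i j : Fin d} (hij : i ≠ j)
    (h1 : (squareDual c i j).Incident P.1) (h2 : (squareDual c i j).Incident Q.1) :
    Linked S P Q := by
  by_cases hPQ : P = Q
  · subst hPQ; exact Linked.refl hP
  · refine ⟨hP, hQ, SimpleGraph.Adj.reachable ?_⟩
    exact ⟨hPQ, squareDual c i j, squareDual_dim c hij, h1, h2⟩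

section Connected

variable {d : ℕ} {D : Set (Fin d → ℤ)}

/-- From a plaquette of direction `j` one can climb to the top of its column of direction `k`. -/
theorem linked_climb (hD : IsLowerSet D) {j k : Fin d} (hjk : j ≠ k) (n : ℕ) :
    ∀ x : Fin d → ℤ, x ∈ D → x + Pi.single j 1 ∉ D → x + Pi.single k (n : ℤ) ∉ D →
      ∃ m : ℕ, Linked (cutSurface D) (dualPlaquette (edgeAt x j))
        (dualPlaquette (edgeAt (x + Pi.single k (m : ℤ)) k)) := by
  induction n with
  | zero => intro x hx _ h; simp [hx] at h
  | succ n ih =>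
    intro x hx hxj hn
    have hP := dualPlaquette_mem_cutSurface.2 ⟨hx, hxj⟩
    by_cases h : x + Pi.single k 1 ∈ D
    · have hj : x + Pi.single k 1 + Pi.single j 1 ∉ D := fun h' => hxj (hD (by
        rw [add_right_comm]; exact le_add_of_nonneg_right (single_one_nonneg k)) h')
      obtain ⟨m, hm⟩ := ih (x + Pi.single k 1) h hj (by
        rw [add_assoc, ← Pi.single_add, add_comm (1 : ℤ)]; exact_mod_cast hn)
      refine ⟨m + 1, Linked.trans ?_ (by
        rw [add_assoc, ← Pi.single_add, add_comm (1 : ℤ)] at hm; exact_mod_cast hm)⟩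
      exact Linked.of_square hP (dualPlaquette_mem_cutSurface.2 ⟨h, hj⟩) hjk (c := x)
        ((squareDual_incident_iff hjk).2 (by simp)) ((squareDual_incident_iff hjk).2 (by simp))
    · refine ⟨0, ?_⟩
      simp only [Nat.cast_zero, Pi.single_zero, add_zero]
      exact Linked.of_square hP (dualPlaquette_mem_cutSurface.2 ⟨hx, h⟩) hjk (c := x)
        ((squareDual_incident_iff hjk).2 (by simp)) ((squareDual_incident_iff hjk).2 (by simp))

/-- From a plaquette of direction `j` one can descend to the top of the next column
of direction `k`. -/
theorem linked_descend (hD : IsLowerSet D) {j k : Fin d} (hjk : j ≠ k) (n : ℕ) :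
    ∀ x : Fin d → ℤ, x ∈ D → x + Pi.single j 1 ∉ D →
      x + Pi.single j 1 - Pi.single k (n : ℤ) ∈ D →
      ∃ m : ℤ, Linked (cutSurface D) (dualPlaquette (edgeAt x j))
        (dualPlaquette (edgeAt (x + Pi.single j 1 + Pi.single k m) k)) := by
  induction n with
  | zero => intro x _ hx h; simp [hx] at h
  | succ n ih =>
    intro x hx hxj hn
    have hP := dualPlaquette_mem_cutSurface.2 ⟨hx, hxj⟩
    have hx' : x - Pi.single k 1 ∈ D := hD (sub_le_self _ (single_one_nonneg k)) hx
    by_cases h : x - Pi.single k 1 + Pi.single j 1 ∈ D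
    · refine ⟨-1, ?_⟩
      have e : x + Pi.single j 1 + Pi.single k (-1) = x - Pi.single k 1 + Pi.single j 1 := by
        rw [Pi.single_neg]; abel
      rw [e]
      refine Linked.of_square hP (dualPlaquette_mem_cutSurface.2 ⟨h, ?_⟩) hjk
        (c := x - Pi.single k 1)
        ((squareDual_incident_iff hjk).2 (by simp)) ((squareDual_incident_iff hjk).2 (by simp))
      rwa [add_right_comm, sub_add_cancel]
    · obtain ⟨m, hm⟩ := ih (x - Pi.single k 1) hx' h (by
        have e : x - Pi.single k 1 + Pi.single j 1 - Pi.single k (n : ℤ) =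
            x + Pi.single j 1 - Pi.single k ((n + 1 : ℕ) : ℤ) := by
          rw [Nat.cast_add, Nat.cast_one, Pi.single_add]; abel
        rwa [e])
      refine ⟨m - 1, Linked.trans ?_ (by
        have e : x + Pi.single j 1 + Pi.single k (m - 1) =
            x - Pi.single k 1 + Pi.single j 1 + Pi.single k m := by
          rw [Pi.single_sub]; abel
        rwa [e])⟩
      exact Linked.of_square hP (dualPlaquette_mem_cutSurface.2 ⟨hx', h⟩) hjk
        (c := x - Pi.single k 1)
        ((squareDual_incident_iff hjk).2 (by simp)) ((squareDual_incident_iff hjk).2 (by simp))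

theorem top_of_column_unique (hD : IsLowerSet D) {x : Fin d → ℤ} {k : Fin d} {s t : ℤ}
    (hs : x + Pi.single k s ∈ D) (ht : x + Pi.single k t + Pi.single k 1 ∉ D) : s ≤ t := by
  by_contra! h
  refine ht (hD ?_ hs)
  rw [add_assoc, ← Pi.single_add]
  exact add_le_add_right (Pi.single_le_single.2 (by omega)) _

theorem exists_top_of_column (hdown : ∀ (x : Fin d → ℤ) (k : Fin d), ∃ n : ℕ, x - Pi.single k (n : ℤ) ∈ D)
    (hup : ∀ (x : Fin d → ℤ) (k : Fin d), ∃ n : ℕ, x + Pi.single k (n : ℤ) ∉ D) (k : Fin d) (x : Fin d → ℤ) :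
    ∃ t : ℤ, x + Pi.single k t ∈ D ∧ x + Pi.single k t + Pi.single k 1 ∉ D := by
  classical
  obtain ⟨n, hn⟩ := hdown x k
  -- Starting from a point of the column inside `D`, the top lies just below the first exit.
  have hex := hup (x - Pi.single k (n : ℤ)) k
  have hmin := fun m => Nat.find_min hex (m := m)
  have hspec := Nat.find_spec hex
  set N := Nat.find hex
  obtain ⟨M, hM⟩ : ∃ M, N = M + 1 := by
    refine Nat.exists_eq_succ_of_ne_zero fun h0 => ?_
    rw [h0] at hspec
    simp [hn] at hspec
  refine ⟨(M : ℤ) - n, ?_, ?_⟩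
  · have := not_not.1 (hmin M (by omega))
    have e : x + Pi.single k ((M : ℤ) - n) = x - Pi.single k (n : ℤ) + Pi.single k (M : ℤ) := by
      rw [Pi.single_sub]; abel
    rwa [e]
  · rw [hM, Nat.cast_add, Nat.cast_one] at hspec
    have e : x + Pi.single k ((M : ℤ) - n) + Pi.single k 1 =
        x - Pi.single k (n : ℤ) + Pi.single k ((M : ℤ) + 1) := by
      rw [Pi.single_sub, Pi.single_add]; abel
    rwa [e]

theorem connected_cutSurface (hD : IsLowerSet D)
    (hdown : ∀ (x : Fin d → ℤ) (k : Fin d), ∃ n : ℕ, x - Pi.single k (n : ℤ) ∈ D)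
    (hup : ∀ (x : Fin d → ℤ) (k : Fin d), ∃ n : ℕ, x + Pi.single k (n : ℤ) ∉ D) (hd : 0 < d) :
    ((plaquetteGraph d).induce (cutSurface D)).Connected := by
  let k : Fin d := ⟨0, hd⟩
  choose h hin hout using exists_top_of_column hdown hup k
  set top : (Fin d → ℤ) → Plaquette d :=
    fun x => dualPlaquette (edgeAt (x + Pi.single k (h x)) k) with htop
  have htop_mem : ∀ x, top x ∈ cutSurface D := fun x =>
    dualPlaquette_mem_cutSurface.2 ⟨hin x, hout x⟩
  have hu : ∀ x t, dualPlaquette (edgeAt (x + Pi.single k t) k) ∈ cutSurface D →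
      dualPlaquette (edgeAt (x + Pi.single k t) k) = top x := by
    intro x t ht
    rw [dualPlaquette_mem_cutSurface] at ht
    have : t = h x := le_antisymm (top_of_column_unique hD ht.1 (hout x))
      (top_of_column_unique hD (hin x) ht.2)
    rw [this]
  have hclimb : ∀ x j, j ≠ k → x ∈ D → x + Pi.single j 1 ∉ D →
      Linked (cutSurface D) (dualPlaquette (edgeAt x j)) (top x) := by
    intro x j hj h1 h2
    obtain ⟨n, hn⟩ := hup x k
    obtain ⟨m, hm⟩ := linked_climb hD hj n x h1 h2 hn
    rwa [hu _ _ hm.2.1] at hm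
  have hdesc : ∀ x j, j ≠ k → x ∈ D → x + Pi.single j 1 ∉ D →
      Linked (cutSurface D) (dualPlaquette (edgeAt x j)) (top (x + Pi.single j 1)) := by
    intro x j hj h1 h2
    obtain ⟨n, hn⟩ := hdown (x + Pi.single j 1) k
    obtain ⟨m, hm⟩ := linked_descend hD hj n x h1 h2 hn
    rwa [hu _ _ hm.2.1] at hm
  -- The top depends only on the column, not on the chosen point of it.
  have hinv : ∀ x t, top (x + Pi.single k t) = top x := by
    intro x t
    have h1 := htop_mem (x + Pi.single k t)
    simp only [htop, add_assoc, ← Pi.single_add] at h1 ⊢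
    exact hu _ _ h1
  have hstep : ∀ x j, Linked (cutSurface D) (top x) (top (x + Pi.single j 1)) := by
    intro x j
    by_cases hj : j = k
    · rw [hj, hinv]; exact Linked.refl (htop_mem x)
    set y := x + Pi.single k (h x) with hy
    have e1 : top x = top y := (hinv x _).symm
    have e2 : top (x + Pi.single j 1) = top (y + Pi.single j 1) := by
      rw [hy, add_right_comm, hinv]
    have e3 : top x = dualPlaquette (edgeAt y k) := rfl
    -- If the neighbour of the top `y` is in `D`, it is the top of its own column, at the same
    -- height. Otherwise the edge between them leaves `D`, and its plaquette is linked to both tops.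
    by_cases hyj : y + Pi.single j 1 ∈ D
    · have h1 : y + Pi.single j 1 + Pi.single k 1 ∉ D := fun h' => hout x (hD (show y + Pi.single k 1 ≤ _ by
        rw [add_right_comm y]; exact le_add_of_nonneg_right (single_one_nonneg j)) h')
      have h2 := dualPlaquette_mem_cutSurface.2 ⟨hyj, h1⟩
      have h3 : dualPlaquette (edgeAt (y + Pi.single j 1) k) = top (y + Pi.single j 1) := by
        have := hu (y + Pi.single j 1) 0
        simp only [Pi.single_zero, add_zero] at this
        exact this h2
      rw [e2, ← h3, e3]
      exact Linked.of_square (htop_mem x) h2 hj (c := y)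
        ((squareDual_incident_iff hj).2 (by simp)) ((squareDual_incident_iff hj).2 (by simp))
    · rw [e1, e2]
      exact (hclimb y j hj (hin x) hyj).symm.trans (hdesc y j hj (hin x) hyj)
  have hall : ∀ z x, Linked (cutSurface D) (top x) (top (x + z)) := by
    -- The translations that preserve the component of every top form a subgroup; it contains the
    -- unit vectors, hence everything.
    let G : AddSubgroup (Fin d → ℤ) :=
      { carrier := {z | ∀ x, Linked (cutSurface D) (top x) (top (x + z))}
        zero_mem' := fun x => by rw [add_zero]; exact Linked.refl (htop_mem x)
        add_mem' := fun {a b} ha hb x => (ha x).trans (by rw [← add_assoc]; exact hb (x + a))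
        neg_mem' := fun {a} ha x => by
          have := (ha (x + -a)).symm
          rwa [neg_add_cancel_right] at this }
    intro z
    have : z ∈ G := by
      rw [← Finset.univ_sum_single z]
      refine G.sum_mem fun i _ => ?_
      have e : (Pi.single i (z i) : Fin d → ℤ) = z i • Pi.single i 1 := by
        rw [← Pi.single_smul]; simp
      rw [e]
      exact G.zsmul_mem (fun x => hstep x i) _
    exact this
  have hbase : ∀ P ∈ cutSurface D, Linked (cutSurface D) P (top 0) := by
    rintro P ⟨x, j, h1, h2, rfl⟩
    have h4 := hall x 0
    rw [zero_add] at h4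
    refine Linked.trans ?_ h4.symm
    by_cases hj : j = k
    · have h5 := dualPlaquette_mem_cutSurface.2 ⟨h1, h2⟩
      have := hu x 0
      subst hj
      simp only [Pi.single_zero, add_zero] at this
      rw [this h5]
      exact Linked.refl (htop_mem x)
    · exact hclimb x j hj h1 h2
  have : Nonempty (cutSurface D) := ⟨⟨top 0, htop_mem 0⟩⟩
  refine SimpleGraph.Connected.mk fun P Q => ?_
  obtain ⟨_, _, h3⟩ := (hbase P.1 P.2).trans (hbase Q.1 Q.2).symm
  exact h3

theorem infinite_cutSurface (hdown : ∀ (x : Fin d → ℤ) (k : Fin d), ∃ n : ℕ, x - Pi.single k (n : ℤ) ∈ D)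
    (hup : ∀ (x : Fin d → ℤ) (k : Fin d), ∃ n : ℕ, x + Pi.single k (n : ℤ) ∉ D) (hd : 2 ≤ d) :
    (cutSurface D).Infinite := by
  let k : Fin d := ⟨0, by omega⟩
  let l : Fin d := ⟨1, by omega⟩
  have hlk : l ≠ k := by simp [l, k]
  choose h hin hout using exists_top_of_column hdown hup k
  -- A second direction `l` provides infinitely many columns, whose tops differ in coordinate `l`.
  refine Set.infinite_of_injective_forall_mem (f := fun t : ℤ =>
    dualPlaquette (edgeAt (Pi.single l t + Pi.single k (h (Pi.single l t))) k)) ?_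
    fun t => dualPlaquette_mem_cutSurface.2 ⟨hin _, hout _⟩
  intro s t hst
  have := congrFun (dualPlaquette_edgeAt_inj.1 hst).1 l
  simpa [hlk] using this

end Connected

/-! ### Uniform homeomorphism with the hyperplane -/

/-- A set that meets every line in the direction `(1, …, 1)` and no two of whose points differ
by a vector with positive coordinates is uniformly homeomorphic to a hyperplane. -/
theorem nonempty_uniformEquiv_hyperplane {d : ℕ} (hd : 0 < d) {C : Set (EuclideanSpace ℝ (Fin d))}
    (hanti : ∀ z ∈ C, ∀ w ∈ C, ¬ ∀ j, z j < w j)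
    (hline : ∀ a : EuclideanSpace ℝ (Fin d), ∃ t : ℝ, a + t • WithLp.toLp 2 1 ∈ C) :
    Nonempty (C ≃ᵤ hyperplane d) := by
  let k : Fin d := ⟨0, hd⟩
  set u : EuclideanSpace ℝ (Fin d) := WithLp.toLp 2 1 with hu
  have hu1 : ∀ j, u j = 1 := fun j => rfl
  choose t ht using hline
  -- The height `t` is 1-Lipschitz: a larger gap would put the point over `y` strictly above the
  -- point over `z` in every coordinate.
  have hle : ∀ y z, t y ≤ t z + dist y z := by
    intro y z
    by_contra! h
    refine hanti _ (ht z) _ (ht y) fun j => ?_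
    have h1 := PiLp.norm_apply_le (y - z) j
    rw [← dist_eq_norm, PiLp.sub_apply, Real.norm_eq_abs, abs_le] at h1
    simp only [PiLp.add_apply, PiLp.smul_apply, hu1, smul_eq_mul, mul_one]
    linarith
  have huniq : ∀ z ∈ C, ∀ s : ℝ, z + s • u ∈ C → s = 0 := by
    intro z hz s hs
    rcases lt_trichotomy s 0 with h | h | h
    · refine absurd (fun j => ?_) (hanti _ hs _ hz)
      simp [hu1, h]
    · exact h
    · refine absurd (fun j => ?_) (hanti _ hz _ hs)
      simp [hu1, h]
  -- The projection along `u` onto the hyperplane.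
  let L : EuclideanSpace ℝ (Fin d) →L[ℝ] EuclideanSpace ℝ (Fin d) :=
    ContinuousLinearMap.id ℝ _ - (EuclideanSpace.proj k).smulRight u
  have hL : ∀ z, L z = z - z k • u := fun z => by simp [L]
  have hLmem : ∀ z, L z ∈ hyperplane d := by
    intro z i hi
    have : i = k := Fin.ext hi
    subst this
    rw [hL]; simp [hu1]
  refine ⟨⟨⟨fun z => ⟨L z, hLmem z⟩, fun y => ⟨y + t y • u, ht y⟩, fun z => ?_, fun y => ?_⟩, ?_, ?_⟩⟩
  · refine Subtype.ext ?_
    have e : L z + t (L z) • u = (z : EuclideanSpace ℝ (Fin d)) + (t (L z) - z.1 k) • u := by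
      rw [hL, sub_smul]; abel
    have h := huniq z z.2 (t (L z) - z.1 k) (e ▸ ht (L z))
    change L z + t (L z) • u = z
    rw [e, h, zero_smul, add_zero]
  · refine Subtype.ext ?_
    have hk : y.1 k = 0 := y.2 k rfl
    change L (y.1 + t y • u) = y
    rw [hL]
    simp [hk, hu1]
  · exact (L.uniformContinuous.comp uniformContinuous_subtype_val).subtype_mk _
  · refine UniformContinuous.subtype_mk ?_ _
    refine LipschitzWith.uniformContinuous (K := 1 + ‖u‖₊) (LipschitzWith.of_dist_le_mul ?_)
    intro y z
    have h1 : |t y - t z| ≤ dist y.1 z.1 := by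
      rw [abs_le]
      have h2 := hle y z
      have h3 := hle z y
      rw [dist_comm] at h3
      constructor <;> linarith
    calc dist (y.1 + t y • u) (z.1 + t z • u)
        ≤ dist y.1 z.1 + dist (t y • u) (t z • u) := dist_add_add_le _ _ _ _
      _ = dist y.1 z.1 + |t y - t z| * ‖u‖ := by
          rw [dist_eq_norm (t y • u), ← sub_smul, norm_smul, Real.norm_eq_abs]
      _ ≤ dist y.1 z.1 + dist y.1 z.1 * ‖u‖ := by gcongr
      _ = ((1 + ‖u‖₊ : NNReal) : ℝ) * dist y z := by
          rw [Subtype.dist_eq]; push_cast; ring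

/-- The points of the plaquette form a product of one- and two-point sets, and the convex hull of a
product is the product of the convex hulls. -/
theorem mem_cube_dualPlaquette_iff {d : ℕ} {x : Fin d → ℤ} {k : Fin d}
    {z : EuclideanSpace ℝ (Fin d)} :
    z ∈ (dualPlaquette (edgeAt x k)).1.cube ↔
      z k = x k + 1 / 2 ∧ ∀ j, j ≠ k → (x j : ℝ) - 1 / 2 ≤ z j ∧ z j ≤ x j + 1 / 2 := by
  let e := (WithLp.linearEquiv 2 ℝ (Fin d → ℝ)).symm
  let t : Fin d → Set ℝ := fun j =>
    if j = k then {(x j : ℝ) + 1 / 2} else {(x j : ℝ) - 1 / 2, (x j : ℝ) + 1 / 2}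
  have h1 : (dualPlaquette (edgeAt x k)).1.shiftedVerts = e.toLinearMap '' Set.univ.pi t := by
    ext w
    have h2 : w ∈ e.toLinearMap '' Set.univ.pi t ↔ ∀ j, w j ∈ t j := by
      constructor
      · rintro ⟨v, hv, rfl⟩ j
        exact hv j trivial
      · exact fun h => ⟨fun j => w j, fun j _ => h j, rfl⟩
    rw [h2]
    refine (Facet.mem_shiftedVerts_dual _ w).trans (forall_congr' fun j => ?_)
    by_cases hj : j = k <;> simp [edgeAt, t, hj]
  rw [Facet.cube, h1, ← LinearMap.image_convexHull, convexHull_pi]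
  have h3 : ∀ j, convexHull ℝ (t j) =
      if j = k then {(x j : ℝ) + 1 / 2} else Set.Icc ((x j : ℝ) - 1 / 2) (x j + 1 / 2) := by
    intro j
    by_cases hj : j = k
    · simp [t, hj]
    · simp only [t, hj, if_false]
      rw [convexHull_pair, segment_eq_Icc (by linarith)]
  have h2 : z ∈ e.toLinearMap '' Set.univ.pi (fun j => convexHull ℝ (t j)) ↔
      ∀ j, z j ∈ convexHull ℝ (t j) := by
    constructor
    · rintro ⟨v, hv, rfl⟩ j
      exact hv j trivial
    · exact fun h => ⟨fun j => z j, fun j _ => h j, rfl⟩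
  rw [h2]
  simp only [h3]
  constructor
  · intro h
    refine ⟨by simpa using h k, fun j hj => by simpa [hj] using h j⟩
  · rintro ⟨h, h'⟩ j
    by_cases hj : j = k
    · subst hj; simp [h]
    · simpa [hj] using h' j hj

/-- The least point of `ℤ^d` at sup-distance at most `1/2` from `z`. -/
noncomputable def lowerCorner {d : ℕ} (z : EuclideanSpace ℝ (Fin d)) : Fin d → ℤ :=
  fun j => ⌈z j - 1 / 2⌉

/-- The greatest point of `ℤ^d` at sup-distance at most `1/2` from `z`. -/
noncomputable def upperCorner {d : ℕ} (z : EuclideanSpace ℝ (Fin d)) : Fin d → ℤ :=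
  fun j => ⌊z j + 1 / 2⌋

/-- A monotone lattice path from inside to outside a set crosses its boundary. -/
theorem exists_crossing {d : ℕ} {D : Set (Fin d → ℤ)} {a b : Fin d → ℤ} (hab : a ≤ b)
    (ha : a ∈ D) (hb : b ∉ D) :
    ∃ x k, a ≤ x ∧ x + Pi.single k 1 ≤ b ∧ x ∈ D ∧ x + Pi.single k 1 ∉ D := by
  by_contra! h
  -- Induction on the number of unit steps that remain from `x` to `b`; without a crossing the path
  -- stays in `D` up to `b`.
  have key : ∀ n : ℕ, ∀ x, a ≤ x → x ≤ b → x ∈ D → ∑ i, (b i - x i) = n → False := by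
    intro n
    induction n with
    | zero =>
      intro x _ hxb hx hs
      have h0 := (Finset.sum_eq_zero_iff_of_nonneg fun i _ => sub_nonneg.2 (hxb i)).1 hs
      have : x = b := funext fun i => by have := h0 i (Finset.mem_univ i); omega
      exact hb (this ▸ hx)
    | succ n ih =>
      intro x hax hxb hx hs
      obtain ⟨k, hk⟩ : ∃ k, x k < b k := by
        by_contra! h'
        have : ∑ i, (b i - x i) ≤ 0 := Finset.sum_nonpos fun i _ => by have := h' i; omega
        omega
      have hxb' : x + Pi.single k 1 ≤ b := by
        intro j
        by_cases hj : j = k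
        · subst hj; simp; omega
        · simpa [hj] using hxb j
      refine ih (x + Pi.single k 1) (hax.trans (le_add_of_nonneg_right (single_one_nonneg k))) hxb'
        (h x k hax hxb' hx) ?_
      have : ∑ i, (b i - (x + Pi.single k 1 : Fin d → ℤ) i) =
          ∑ i, (b i - x i) - ∑ i, (Pi.single k 1 : Fin d → ℤ) i := by
        rw [← Finset.sum_sub_distrib]
        exact Finset.sum_congr rfl fun i _ => by simp; ring
      rw [this, hs, Finset.sum_pi_single']
      simp
  exact key (∑ i, (b i - a i)).toNat a le_rfl hab ha
    (Int.toNat_of_nonneg (Finset.sum_nonneg fun i _ => sub_nonneg.2 (hab i))).symm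

/-- The lattice points within sup-distance 1/2 of `z` form the box between the two corners, and the
cube dual to an edge contains `z` exactly when both ends of the edge lie in this box. A monotone
path between the corners supplies such an edge leaving `D`. -/
theorem mem_carrier_cutSurface_iff {d : ℕ} {D : Set (Fin d → ℤ)} (hD : IsLowerSet D)
    {z : EuclideanSpace ℝ (Fin d)} :
    z ∈ carrier (cutSurface D) ↔ lowerCorner z ∈ D ∧ upperCorner z ∉ D := by
  constructor
  · intro h
    simp only [carrier, Set.mem_iUnion] at h
    obtain ⟨_, ⟨x, k, h1, h2, rfl⟩, h⟩ := h
    obtain ⟨h3, h4⟩ := mem_cube_dualPlaquette_iff.1 h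
    refine ⟨hD (fun j => ?_) h1, fun h5 => h2 (hD (fun j => ?_) h5)⟩
    · rw [lowerCorner, Int.ceil_le]
      by_cases hj : j = k
      · subst hj; rw [h3]; simp
      · linarith [(h4 j hj).2]
    · rw [upperCorner, Int.le_floor]
      by_cases hj : j = k
      · subst hj; rw [h3]; simp; norm_num [add_assoc]
      · simp only [Pi.add_apply, ne_eq, hj, not_false_eq_true, Pi.single_eq_of_ne, add_zero]
        linarith [(h4 j hj).1]
  · rintro ⟨h1, h2⟩
    have hle : lowerCorner z ≤ upperCorner z := by
      intro j
      rw [lowerCorner, upperCorner, Int.ceil_le]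
      have := Int.lt_floor_add_one (z j + 1 / 2)
      linarith
    obtain ⟨x, k, hx1, hx2, hx3, hx4⟩ := exists_crossing hle h1 h2
    simp only [carrier, Set.mem_iUnion]
    refine ⟨_, ⟨x, k, hx3, hx4, rfl⟩, mem_cube_dualPlaquette_iff.2 ?_⟩
    have hlow : ∀ j, z j ≤ x j + 1 / 2 := by
      intro j
      have := hx1 j
      rw [lowerCorner, Int.ceil_le] at this
      linarith
    have hupp : ∀ j, ((x + Pi.single k 1 : Fin d → ℤ) j : ℝ) ≤ z j + 1 / 2 := by
      intro j
      have := hx2 j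
      rwa [upperCorner, Int.le_floor] at this
    constructor
    · have h3 := hupp k
      simp only [Pi.add_apply, Pi.single_eq_same, Int.cast_add, Int.cast_one] at h3
      linarith [hlow k]
    · intro j hj
      have h3 := hupp j
      simp only [Pi.add_apply, ne_eq, hj, not_false_eq_true, Pi.single_eq_of_ne, add_zero] at h3
      exact ⟨by linarith, hlow j⟩

theorem uniformlyHomeomorphic_cutSurface {d : ℕ} (hd : 0 < d) {D : Set (Fin d → ℤ)}
    (hD : IsLowerSet D) (hdown : ∀ x : Fin d → ℤ, ∃ n : ℕ, (fun j => x j - n) ∈ D)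
    (hup : ∃ n : ℕ, (fun _ => (n : ℤ)) ∉ D) :
    UniformlyHomeomorphicToHyperplane (cutSurface D) := by
  refine nonempty_uniformEquiv_hyperplane hd ?_ ?_
  · intro z hz w hw h
    rw [mem_carrier_cutSurface_iff hD] at hz hw
    refine hz.2 (hD (fun j => ?_) hw.1)
    rw [upperCorner, lowerCorner, ← Int.lt_add_one_iff, Int.floor_lt]
    push_cast
    linarith [h j, Int.le_ceil (w j - 1 / 2)]
  · intro a
    set p : ℝ → EuclideanSpace ℝ (Fin d) := fun t => a + t • WithLp.toLp 2 1 with hp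
    have hpj : ∀ t j, p t j = a j + t := fun t j => by simp [hp]
    let A : Set ℝ := {t | lowerCorner (p t) ∈ D}
    have hA1 : A.Nonempty := by
      obtain ⟨n, hn⟩ := hdown (lowerCorner (p 0))
      refine ⟨-n, ?_⟩
      have : lowerCorner (p (-n)) = fun j => lowerCorner (p 0) j - n := by
        funext j
        rw [lowerCorner, lowerCorner, hpj, hpj, ← Int.ceil_sub_natCast]
        congr 1; ring
      change lowerCorner (p (-n)) ∈ D
      rwa [this]
    have hA2 : BddAbove A := by
      obtain ⟨n, hn⟩ := hup
      obtain ⟨M, hM⟩ := (Set.finite_range fun j => -a j).bddAbove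
      refine ⟨n + 1 / 2 + M, fun t ht => ?_⟩
      by_contra! h
      refine hn (hD (fun j => ?_) ht)
      have h1 : -a j ≤ M := hM ⟨j, rfl⟩
      rw [lowerCorner, hpj, ← Int.cast_le (R := ℝ)]
      refine le_trans ?_ (Int.le_ceil _)
      push_cast
      linarith
    -- The line meets the surface where it last has its lower corner in `D`. Ceilings are lower
    -- semicontinuous, so the supremum is attained; slightly beyond `T` the lower corner is still
    -- below the upper corner at `T`, which therefore cannot be in `D`.
    set T := sSup A with hT
    refine ⟨T, (mem_carrier_cutSurface_iff hD).2 ⟨?_, ?_⟩⟩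
    · have hev : ∀ᶠ t in 𝓝 T, lowerCorner (p T) ≤ lowerCorner (p t) := by
        simp only [Pi.le_def]
        rw [eventually_all]
        intro j
        have h1 : (⌈a j + T - 1 / 2⌉ : ℝ) - 1 - a j + 1 / 2 < T := by
          linarith [Int.ceil_lt_add_one (a j + T - 1 / 2)]
        filter_upwards [lt_mem_nhds h1] with t ht
        rw [lowerCorner, lowerCorner, hpj, hpj, Int.le_ceil_iff]
        linarith
      have hfr : ∃ᶠ t in 𝓝 T, t ∈ A := mem_closure_iff_frequently.1 (csSup_mem_closure hA1 hA2)
      obtain ⟨t, ht1, ht2⟩ := (hfr.and_eventually hev).exists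
      exact hD ht2 ht1
    · have hev : ∀ᶠ t in 𝓝 T, lowerCorner (p t) ≤ upperCorner (p T) := by
        simp only [Pi.le_def]
        rw [eventually_all]
        intro j
        have h1 : T < (⌊a j + T + 1 / 2⌋ : ℝ) - a j + 1 / 2 := by
          linarith [Int.lt_floor_add_one (a j + T + 1 / 2)]
        filter_upwards [gt_mem_nhds h1] with t ht
        rw [lowerCorner, upperCorner, hpj, hpj, Int.ceil_le]
        linarith
      have hgt : ∃ᶠ t in 𝓝[>] T, True := by
        rw [frequently_true_iff_neBot]; infer_instance
      have hfr : ∃ᶠ t in 𝓝 T, T < t := by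
        rw [frequently_nhdsWithin_iff] at hgt
        exact hgt.mono fun t h => h.2
      obtain ⟨t, ht1, ht2⟩ := (hfr.and_eventually hev).exists
      exact fun h => absurd (le_csSup hA2 (hD ht2 h : t ∈ A)) (not_le.2 ht1)

/-! ### Vertices reachable from a half-space -/

/-- The sum of the coordinates. -/
def level {d : ℕ} : (Fin d → ℤ) →+ ℤ := ∑ i, Pi.evalAddMonoidHom (fun _ : Fin d => ℤ) i

theorem level_apply {d : ℕ} (x : Fin d → ℤ) : level x = ∑ i, x i := by
  simp [level]

theorem level_single {d : ℕ} (k : Fin d) (t : ℤ) : level (Pi.single k t) = t := by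
  rw [level_apply, Finset.sum_pi_single']
  simp

/-- A step from `u` to `v` is either downwards, or upwards through an open edge. -/
def Step {d : ℕ} (ω : Config d) (u v : Fin d → ℤ) : Prop :=
  (∃ k, u = v + Pi.single k 1) ∨ ∃ k, v = u + Pi.single k 1 ∧ ω (edgeAt u k) = true

/-- The vertices that can be reached by steps from the half-space of nonpositive level. -/
def reachableSet {d : ℕ} (ω : Config d) : Set (Fin d → ℤ) :=
  {v | ∃ u, level u ≤ 0 ∧ Relation.ReflTransGen (Step ω) u v}

theorem mem_reachableSet_of_level {d : ℕ} (ω : Config d) {v : Fin d → ℤ} (hv : level v ≤ 0) :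
    v ∈ reachableSet ω := ⟨v, hv, .refl⟩

theorem mem_reachableSet_of_step {d : ℕ} {ω : Config d} {u v : Fin d → ℤ}
    (hu : u ∈ reachableSet ω) (h : Step ω u v) : v ∈ reachableSet ω := by
  obtain ⟨a, ha, hau⟩ := hu
  exact ⟨a, ha, hau.tail h⟩

theorem isLowerSet_reachableSet {d : ℕ} (ω : Config d) : IsLowerSet (reachableSet ω) := by
  intro a b hba ha
  by_contra hb
  obtain ⟨x, k, -, -, h1, h2⟩ := exists_crossing (D := (reachableSet ω)ᶜ) hba hb (not_not.2 ha)
  exact h1 (mem_reachableSet_of_step (not_not.1 h2) (Or.inl ⟨k, rfl⟩))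

theorem isOpenPlaquette_of_mem_cutSurface {d : ℕ} {ω : Config d} {P : Plaquette d}
    (hP : P ∈ cutSurface (reachableSet ω)) : IsOpenPlaquette ω P := by
  obtain ⟨x, k, h1, h2, rfl⟩ := hP
  refine ⟨_, rfl, Bool.eq_false_iff.2 fun h => h2 ?_⟩
  exact mem_reachableSet_of_step h1 (Or.inr ⟨k, rfl, h⟩)

theorem exists_walk_of_mem_reachableSet {d : ℕ} {ω : Config d} {v : Fin d → ℤ}
    (hv : v ∈ reachableSet ω) : ∃ n, ∃ w : ℕ → Fin d → ℤ, w 0 = v ∧ level (w n) ≤ 0 ∧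
      ∀ i < n, Step ω (w (i + 1)) (w i) := by
  obtain ⟨u, hu, h⟩ := hv
  induction h with
  | refl => exact ⟨0, fun _ => u, rfl, hu, by simp⟩
  | @tail b c _ hbc ih =>
    obtain ⟨n, w, h0, hn, hw⟩ := ih
    refine ⟨n + 1, fun i => Nat.casesOn i c w, rfl, hn, fun i hi => ?_⟩
    cases i with
    | zero => change Step ω (w 0) c; rwa [h0]
    | succ i => exact hw i (by omega)

/-- A walk of minimal length is self-avoiding, since a loop could be cut out. -/
theorem exists_injOn_walk_of_mem_reachableSet {d : ℕ} {ω : Config d} {v : Fin d → ℤ}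
    (hv : v ∈ reachableSet ω) : ∃ n, ∃ w : ℕ → Fin d → ℤ, w 0 = v ∧ level (w n) ≤ 0 ∧
      (∀ i < n, Step ω (w (i + 1)) (w i)) ∧ Set.InjOn w (Set.Iic n) := by
  classical
  have hex := exists_walk_of_mem_reachableSet hv
  have hmin := fun m => Nat.find_min hex (m := m)
  obtain ⟨w, h0, hn, hw⟩ := Nat.find_spec hex
  set n := Nat.find hex
  refine ⟨n, w, h0, hn, hw, ?_⟩
  have key : ∀ i j, i < j → j ≤ n → w i ≠ w j := by
    intro i j hij hj h
    refine hmin (n - (j - i)) (by omega)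
      -- The walk with the loop between times `i` and `j` removed.
      ⟨fun l => if l ≤ i then w l else w (l + (j - i)), by simp [h0], ?_, fun l hl => ?_⟩
    · dsimp only
      by_cases hjn : j = n
      · rw [if_pos (by omega), show n - (j - i) = i by omega, h, hjn]
        exact hn
      · rw [if_neg (by omega), show n - (j - i) + (j - i) = n by omega]
        exact hn
    · dsimp only
      rcases lt_trichotomy l i with hl' | rfl | hl'
      · rw [if_pos (by omega), if_pos (by omega)]
        exact hw l (by omega)
      · rw [if_neg (by omega), if_pos le_rfl, show l + 1 + (j - l) = j + 1 by omega, h]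
        exact hw j (by omega)
      · rw [if_neg (by omega), if_neg (by omega), show l + 1 + (j - i) = l + (j - i) + 1 by omega]
        exact hw _ (by omega)
  intro i hi j hj h
  rcases lt_trichotomy i j with h' | h' | h'
  · exact absurd h (key i j h' hj)
  · exact h'
  · exact absurd h.symm (key j i h' hi)

/-! ### Path counting and the probability estimate -/

/-- The event that the translate by `v` of the reversal of `s` leads from the half-space of
nonpositive level to `v`. -/
def walkEvent {d n : ℕ} (v : Fin d → ℤ) (s : Fin (n + 1) → Fin d → ℤ) : Set (Config d) :=
  {ω | level (v + s (Fin.last n)) ≤ 0 ∧ ∀ i : Fin n, Step ω (v + s i.succ) (v + s i.castSucc)}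

/-- The indices of the steps of `s` that lead downwards. -/
def descents {d n : ℕ} (s : Fin (n + 1) → Fin d → ℤ) : Set (Fin n) :=
  {i | ∃ k, s i.castSucc = s i.succ + Pi.single k 1}

open Classical in
-- Each step changes the level by exactly 1, so the sum telescopes to descents minus ascents.
theorem level_sub_level {d n : ℕ} {s : Fin (n + 1) → Fin d → ℤ} (hs : s ∈ saws d n) :
    level (s 0) - level (s (Fin.last n)) = 2 * ((descents s).toFinset.card : ℤ) - n := by
  have h1 := Fin.sum_univ_castSucc fun i => level (s i)
  rw [Fin.sum_univ_succ] at h1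
  have h2 : ∀ i : Fin n, level (s i.castSucc) - level (s i.succ) =
      2 * (if i ∈ descents s then 1 else 0) - 1 := by
    intro i
    by_cases hi : i ∈ descents s
    · obtain ⟨k, hk⟩ := id hi
      rw [if_pos hi, hk, map_add, level_single]
      ring
    · obtain ⟨k, hk | hk⟩ := lattice_adj_iff.1 (hs.2.2 i)
      · rw [if_neg hi, hk, map_add, level_single]
        ring
      · exact absurd ⟨k, hk⟩ hi
  have h3 := Finset.sum_congr rfl fun i (_ : i ∈ (Finset.univ : Finset (Fin n))) => h2 i
  rw [Finset.sum_sub_distrib, Finset.sum_sub_distrib, ← Finset.mul_sum, Finset.sum_boole] at h3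
  have h4 : (descents s).toFinset = Finset.univ.filter (· ∈ descents s) := by
    ext; simp
  rw [h4]
  simp only [Finset.sum_const, Finset.card_univ, Fintype.card_fin, nsmul_eq_mul, mul_one] at h3
  linarith

/-- The walk is read backwards from `v`, so that its translate starts at the origin; coming down
from level at least `N` takes at least `N` steps. -/
theorem mem_reachableSet_subset {d : ℕ} (v : Fin d → ℤ) {N : ℕ} (hN : (N : ℤ) ≤ level v) :
    {ω : Config d | v ∈ reachableSet ω} ⊆ ⋃ m : ℕ, ⋃ s ∈ (saws_finite d (m + N)).toFinset,
      walkEvent v s := by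
  classical
  intro ω hω
  obtain ⟨n, w, h0, hn, hw, hinj⟩ := exists_injOn_walk_of_mem_reachableSet hω
  let s : Fin (n + 1) → Fin d → ℤ := fun i => w i - v
  have hsw : ∀ i, v + s i = w i := fun i => by simp [s]
  have hs : s ∈ saws d n := by
    refine ⟨by simp [s, h0], fun i j h => ?_, fun i => ?_⟩
    · exact Fin.ext (hinj (Nat.lt_succ_iff.1 i.2) (Nat.lt_succ_iff.1 j.2) (sub_left_injective h))
    · rw [lattice_adj_iff]
      rcases hw i i.2 with ⟨k, hk⟩ | ⟨k, hk, -⟩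
      · exact ⟨k, Or.inl (by simp [s, hk]; abel)⟩
      · exact ⟨k, Or.inr (by simp [s, hk]; abel)⟩
  have hE : ω ∈ walkEvent v s := by
    refine ⟨by rw [hsw]; exact hn, fun i => ?_⟩
    rw [hsw, hsw]
    exact hw i i.2
  have hlev := level_sub_level hs
  have hcard := Finset.card_le_univ (descents s).toFinset
  rw [Fintype.card_fin] at hcard
  have h5 := hE.1
  rw [map_add] at h5
  rw [hs.1, map_zero] at hlev
  obtain ⟨m, rfl⟩ : ∃ m, n = m + N := ⟨n - N, by omega⟩
  simp only [Set.mem_iUnion, Set.Finite.mem_toFinset]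
  exact ⟨m, s, hs, hE⟩

theorem bondMeasure_walkEvent_le {d n : ℕ} (hd : 1 ≤ d) (p : unitInterval) {v : Fin d → ℤ} (hv : 0 ≤ level v)
    {s : Fin (n + 1) → Fin d → ℤ} (hs : s ∈ saws d n) :
    bondMeasure d p (walkEvent v s) ≤
      ((NNReal.sqrt (unitInterval.toNNReal p) ^ n : NNReal) : ENNReal) := by
  classical
  by_cases hlast : level (v + s (Fin.last n)) ≤ 0
  swap
  · have : walkEvent v s = ∅ := Set.eq_empty_iff_forall_notMem.2 fun ω h => hlast h.1
    rw [this, measure_empty]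
    exact zero_le
  have hex : ∀ i ∈ (descents s).toFinset, ∃ k, s i.castSucc = s i.succ + Pi.single k 1 :=
    fun i hi => (Set.mem_toFinset.1 hi : i ∈ descents s)
  have : Nonempty (Fin d) := ⟨⟨0, hd⟩⟩
  choose! k hk using hex
  let f : Fin n → Edge d := fun i => edgeAt (v + s i.succ) (k i)
  have hf : Set.InjOn f (descents s).toFinset := by
    intro i _ j _ h
    have := congrArg (fun e => e.1.base) h
    exact Fin.succ_injective _ (hs.2.1 (add_right_injective v this))
  -- A descent of `s` is an upward step towards `v`, so its edge is open; these edges have distinct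
  -- base points because `s` is self-avoiding.
  have hsub : walkEvent v s ⊆
      Set.pi ((descents s).toFinset.image f : Finset (Edge d)) fun _ => {true} := by
    rintro ω ⟨-, h⟩ e he
    obtain ⟨i, hi, rfl⟩ := Finset.mem_image.1 (Finset.mem_coe.1 he)
    have h1 := hk i hi
    rcases h i with ⟨l, hl⟩ | ⟨l, hl, hω⟩
    · have := congrArg level hl
      rw [h1] at this
      simp only [map_add, level_single] at this
      omega
    · rw [h1, ← add_assoc] at hl
      have h2 := add_left_cancel hl
      have h3 : k i = l := by
        by_contra hne
        have := congrFun h2 (k i)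
        simp [hne] at this
      simp only [f, Set.mem_singleton_iff]
      rwa [h3]
  refine (measure_mono hsub).trans ?_
  rw [bondMeasure, Measure.infinitePi_pi _ fun _ _ => MeasurableSet.singleton _,
    Finset.prod_image hf]
  simp only [bernoulliMeasure_apply p (MeasurableSet.singleton true), Set.mem_singleton_iff,
    if_true, Bool.false_eq_true, if_false, Finset.prod_const]
  -- From nonnegative to nonpositive level, at least half of the steps go down.
  have hcard : n ≤ 2 * (descents s).toFinset.card := by
    have hlev := level_sub_level hs
    rw [map_add] at hlast
    rw [hs.1, map_zero] at hlev
    omega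
  rw [← ENNReal.coe_pow, ENNReal.coe_le_coe]
  calc unitInterval.toNNReal p ^ (descents s).toFinset.card
      = NNReal.sqrt (unitInterval.toNNReal p) ^ (2 * (descents s).toFinset.card) := by
        rw [pow_mul, NNReal.sq_sqrt]
    _ ≤ NNReal.sqrt (unitInterval.toNNReal p) ^ n :=
        pow_le_pow_of_le_one zero_le (NNReal.sqrt_le_one.2 p.2.2) hcard

theorem bondMeasure_mem_reachableSet_le {d : ℕ} (hd : 1 ≤ d) (p : unitInterval) {v : Fin d → ℤ} {N : ℕ}
    (hN : (N : ℤ) ≤ level v) :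
    bondMeasure d p {ω | v ∈ reachableSet ω} ≤ ∑' m : ℕ,
      ((sawCount d (m + N) * NNReal.sqrt (unitInterval.toNNReal p) ^ (m + N) : NNReal) :
        ENNReal) := by
  refine (measure_mono (mem_reachableSet_subset v hN)).trans ((measure_iUnion_le _).trans ?_)
  refine ENNReal.tsum_le_tsum fun m => ?_
  refine (measure_biUnion_finset_le _ _).trans ?_
  refine (Finset.sum_le_card_nsmul _ _ _ fun s hs => bondMeasure_walkEvent_le hd p (by omega)
    ((Set.Finite.mem_toFinset _).1 hs)).trans (le_of_eq ?_)
  rw [← Set.ncard_eq_toFinset_card _ (saws_finite d (m + N)), nsmul_eq_mul]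
  push_cast
  rfl

/-- The root test: the n-th roots of the terms tend to `connectiveConstant d * q`. -/
theorem summable_sawCount_mul_pow {d : ℕ} (hd : 1 ≤ d) {q : NNReal}
    (hq : connectiveConstant d * q < 1) :
    Summable fun n : ℕ => (sawCount d n * q ^ n : NNReal) := by
  rw [← NNReal.summable_coe]
  obtain ⟨r, hr1, hr2⟩ := exists_between (max_lt hq zero_lt_one)
  have hr0 : 0 ≤ r := (le_max_right _ _).trans hr1.le
  have ht := (tendsto_connectiveConstant hd).mul_const (q : ℝ)
  have hev := ht.eventually (gt_mem_nhds ((le_max_left _ _).trans_lt hr1))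
  refine Summable.of_norm_bounded_eventually_nat (summable_geometric_of_lt_one hr0 hr2) ?_
  filter_upwards [hev, eventually_ge_atTop 1] with n hn hn1
  rw [Real.norm_of_nonneg (by positivity)]
  have h1 := pow_le_pow_left₀ (by positivity) hn.le n
  rw [mul_pow, one_div, Real.rpow_inv_natCast_pow (by positivity) (by omega)] at h1
  exact_mod_cast h1

theorem ae_exists_notMem_reachableSet {d : ℕ} (hd : 1 ≤ d) (p : unitInterval)
    (hp : (p : ℝ) < (connectiveConstant d) ^ (-2 : ℤ)) :
    ∀ᵐ ω ∂(bondMeasure d p), ∀ (x : Fin d → ℤ) (k : Fin d),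
      ∃ n : ℕ, x + Pi.single k (n : ℤ) ∉ reachableSet ω := by
  have hq : connectiveConstant d * NNReal.sqrt (unitInterval.toNNReal p) < 1 := by
    -- The hypothesis excludes a vanishing constant, because then its inverse square would be 0 by
    -- convention, while `p` is nonnegative.
    have h1 : (0 : ℝ) < connectiveConstant d ^ 2 := by
      have h2 := p.2.1.trans_lt hp
      rw [zpow_neg, inv_pos] at h2
      exact_mod_cast h2
    have h3 : (p : ℝ) * connectiveConstant d ^ 2 < 1 := by
      rw [zpow_neg, ← one_div] at hp
      exact (lt_div_iff₀ h1).1 (by exact_mod_cast hp)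
    have h4 : ((NNReal.sqrt (unitInterval.toNNReal p) : NNReal) : ℝ) ^ 2 = p := by
      rw [← NNReal.coe_pow, NNReal.sq_sqrt]; rfl
    refine lt_of_pow_lt_pow_left₀ 2 zero_le_one ?_
    rw [mul_pow, h4, one_pow, mul_comm]
    exact h3
  have hsum := summable_sawCount_mul_pow hd hq
  have htail := ENNReal.tendsto_sum_nat_add _ (ENNReal.tsum_coe_ne_top_iff_summable.2 hsum)
  rw [ae_all_iff]
  intro x
  rw [ae_all_iff]
  intro k
  rw [ae_iff]
  simp only [not_exists, not_not]
  refine le_antisymm (ge_of_tendsto' htail fun N => ?_) zero_le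
  -- A ray contained in the reachable set contains a point of level at least `N` for every `N`, so
  -- the probability of this is below every tail of the series.
  have hlev : (N : ℤ) ≤ level (x + Pi.single k ((((N : ℤ) - level x).toNat : ℕ) : ℤ)) := by
    rw [map_add, level_single]
    omega
  exact (measure_mono (Set.ofPred_subset_ofPred.2 fun ω h => h _)).trans (bondMeasure_mem_reachableSet_le hd p hlev)

end PlaquettePercolation

open PlaquettePercolation
theorem mainTheorem9 (d : ℕ) (hd : 2 ≤ d) (p : unitInterval)
    (hp : (p : ℝ) < (connectiveConstant d) ^ (-2 : ℤ)) :
    ∀ᵐ ω ∂(bondMeasure d p), ∃ S : Set (Plaquette d),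
      S.Infinite ∧ IsSurface S ∧ (∀ P ∈ S, IsOpenPlaquette ω P) ∧
        UniformlyHomeomorphicToHyperplane S := by
  filter_upwards [ae_exists_notMem_reachableSet (by omega) p hp] with ω hup
  have hD := isLowerSet_reachableSet ω
  have hdown : ∀ (x : Fin d → ℤ) (k : Fin d), ∃ n : ℕ,
      x - Pi.single k (n : ℤ) ∈ reachableSet ω := fun x k =>
    ⟨(level x).toNat, mem_reachableSet_of_level ω (by rw [map_sub, level_single]; omega)⟩
  refine ⟨cutSurface (reachableSet ω), infinite_cutSurface hdown hup hd,
    ⟨connected_cutSurface hD hdown hup (by omega), boundary_cutSurface hD⟩,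
    fun P hP => isOpenPlaquette_of_mem_cutSurface hP,
    uniformlyHomeomorphic_cutSurface (by omega) hD (fun x => ?_) ?_⟩
  · obtain ⟨n, hn⟩ := hdown x ⟨0, by omega⟩
    -- Lowering all coordinates by `n` gives a point below the one lowered in a single coordinate.
    refine ⟨n, hD (fun j => ?_) hn⟩
    have h1 : (Pi.single ⟨0, by omega⟩ (n : ℤ) : Fin d → ℤ) j ≤ n := by
      rw [Pi.single_apply]; split_ifs <;> omega
    simp only [Pi.sub_apply]
    omega
  · obtain ⟨n, hn⟩ := hup 0 ⟨0, by omega⟩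
    refine ⟨n, fun h => hn (hD (fun j => ?_) h)⟩
    rw [zero_add, Pi.single_apply]
    split_ifs
    exacts [le_rfl, Int.natCast_nonneg n]
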